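/- Let $\mathcal X$ be a measurable space, let $\mathbb C$ be a class of measurable functions $\mathcal X\to\{0,1\}$ (classifiers) with VC dimension $d$, $1\le d<\infty$, and let $\mathcal P$ be a probability measure on $\mathcal X$. Assume the usual measurability condition of VC theory: for every $n$ and every $y\in\{0,1\}^n$, the set of $(x_1,\dots,x_n)\in\mathcal X^n$ for which some $h\in\mathbb C$ satisfies $h(x_i)=y_i$ for all $i$ is measurable with respect to the completion of $\mathcal P^n$. Let $X_1,X_2,\dots$ be independent with law $\mathcal P$. For a non-random sequence $\mathbf h^*=(h^*_1,h^*_2,\dots)$ in $\mathbb C$, put $Y_t=h^*_t(X_t)$ and $\mathrm{er}_t(h)=\mathcal P(x: h(x)\ne h^*_t(x))$. For a sequence $\boldsymbol\Delta=(\Delta_t)_{t\ge2}$ in $[0,1]$, let $S_{\boldsymbol\Delta}$ be the set of all sequences $\mathbf h^*$ in $\mathbb C$ with $\mathcal P(x:h^*_t(x)\ne h^*_{t+1}(x))\le\Delta_{t+1}$ for all $t\ge1$. Let $\mathrm{Log}(x)=\ln(\max\{x,e\})$. Given a constant $K\ge1$ and $\delta\in(0,1)$, the adaptive algorithm computes,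 for each $T\ge2$, from the observations $(X_1,Y_1),\dots,(X_{T-1},Y_{T-1})$, $$\hat m_T=\max\Big\{m\in\{1,\dots,T-1\}:\ \min_{h\in\mathbb C}\ \max_{1\le m'\le m}\frac{\sum_{t=T-m'}^{T-1}\mathbf 1[h(X_t)\ne Y_t]}{d\,\mathrm{Log}(m'/d)+\mathrm{Log}(1/\delta)}<K\Big\},$$ $$\hat h_T\in\operatorname*{argmin}_{h\in\mathbb C}\ \max_{1\le m'\le\hat m_T}\frac{\sum_{t=T-m'}^{T-1}\mathbf 1[h(X_t)\ne Y_t]}{d\,\mathrm{Log}(m'/d)+\mathrm{Log}(1/\delta)},$$ with any rule, depending only on the observations, for breaking ties in the argmin. In particular the algorithm does not depend on $\boldsymbol\Delta$, $\mathcal P$ or $\mathbf h^*$. Theorem. There are universal constants $K\ge1$ and $c>0$ such that, for all $\mathcal X$, $\mathbb C$, $d$ and $\delta\in(0,1)$ as above, the adaptive algorithm with this $K$ is well defined (the maximum and the argmin exist), and for every such $\mathcal P$, every sequence $\boldsymbol\Delta$ in $[0,1]$, every $\mathbf h^*\in S_{\boldsymbol\Delta}$ and every $T\ge2$, with probability at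 least $1-\delta$, $$\mathrm{er}_T(\hat h_T)\le c\,\min_{1\le m\le T-1}\left(\frac1m\sum_{i=T-m}^{T-1}\sum_{j=i+1}^{T}\Delta_j+\frac{d\,\mathrm{Log}(m/d)+\mathrm{Log}(1/\delta)}{m}\right).$$ -/

import Mathlib

open MeasureTheory ProbabilityTheory

noncomputable section

namespace DriftLearning

/-- The truncated logarithm `Log x = ln (max {x, e})`. -/
def Log (x : ℝ) : ℝ := Real.log (max x (Real.exp 1))

/-- The complexity term `d Log(m/d) + Log(1/δ)`. -/
def complexity (d : ℕ) (δ : ℝ) (m : ℕ) : ℝ :=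
  d * Log ((m : ℝ) / d) + Log (1 / δ)

/-- A finite set `s` of points is shattered by the class `C` of binary classifiers if every
labelling of `s` is realized by some member of `C`. -/
def Shatters {𝒳 : Type*} (C : Set (𝒳 → Bool)) (s : Finset 𝒳) : Prop :=
  ∀ f : 𝒳 → Bool, ∃ h ∈ C, ∀ x ∈ s, h x = f x

/-- The VC dimension of `C` is (finite and) equal to `d`: the largest cardinality of a finite set
shattered by `C` is `d`. -/
def HasVCDim {𝒳 : Type*} (C : Set (𝒳 → Bool)) (d : ℕ) : Prop :=
  IsGreatest {n : ℕ | ∃ s : Finset 𝒳, s.card = n ∧ Shatters C s} d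

/-- The usual measurability requirement of VC theory on a class `C` under `P`: for every `n` and
every labelling `y` of `n` points, the set of samples `(x₁, …, xₙ)` on which some `h ∈ C`
realizes `y` is measurable with respect to the completion of `Pⁿ`. -/
def MeasurableRealization {𝒳 : Type*} [MeasurableSpace 𝒳] (C : Set (𝒳 → Bool))
    (P : Measure 𝒳) : Prop :=
  ∀ (n : ℕ) (y : Fin n → Bool),
    NullMeasurableSet {x : Fin n → 𝒳 | ∃ h ∈ C, ∀ i, h (x i) = y i} (Measure.pi fun _ => P)

/-- The probability `P(x : h(x) ≠ g(x))`. -/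
def disagreement {𝒳 : Type*} [MeasurableSpace 𝒳] (P : Measure 𝒳) (h g : 𝒳 → Bool) : ℝ :=
  P.real {x | h x ≠ g x}

/-- The set `S_Δ` of sequences `h₁, h₂, …` in `C` with `P(x : h_t(x) ≠ h_{t+1}(x)) ≤ Δ_{t+1}` for
all `t ≥ 1`.  (Times start at `1`; the values of `h` at `0` and of `Δ` at `0`, `1` play no role.) -/
def driftSet {𝒳 : Type*} [MeasurableSpace 𝒳] (C : Set (𝒳 → Bool)) (P : Measure 𝒳)
    (Δ : ℕ → ℝ) : Set (ℕ → 𝒳 → Bool) :=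
  {h | ∀ t, 1 ≤ t → h t ∈ C ∧ disagreement P (h t) (h (t + 1)) ≤ Δ (t + 1)}

/-- The labelled observations `(x₁, y₁), …, (x_{T-1}, y_{T-1})` available at time `T`. -/
abbrev Sample (𝒳 : Type*) (T : ℕ) : Type _ := Finset.Ico 1 T → 𝒳 × Bool

/-- The number of mistakes of `h` on the last `m` observations, `∑_{t=T-m}^{T-1} 1[h(x_t) ≠ y_t]`
(used for `m ≤ T - 1`). -/
def mistakes {𝒳 : Type*} {T : ℕ} (S : Sample 𝒳 T) (m : ℕ) (h : 𝒳 → Bool) : ℕ :=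
  (Finset.univ.filter fun t : Finset.Ico 1 T => T - m ≤ (t : ℕ) ∧ h (S t).1 ≠ (S t).2).card

/-- `max_{1 ≤ m' ≤ m} (∑_{t=T-m'}^{T-1} 1[h(x_t) ≠ y_t]) / (d Log(m'/d) + Log(1/δ))`
(used for `m ≥ 1`; a supremum over a finite nonempty index set, hence a maximum). -/
def maxRatio {𝒳 : Type*} (d : ℕ) (δ : ℝ) {T : ℕ} (S : Sample 𝒳 T) (m : ℕ) (h : 𝒳 → Bool) : ℝ :=
  ⨆ m' : Finset.Icc 1 m, (mistakes S m' h : ℝ) / complexity d δ m'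

/-- The window lengths `m ∈ {1, …, T-1}` for which the minimum over `h ∈ C` of `maxRatio` is
less than `K`. -/
def admissibleWindows {𝒳 : Type*} (C : Set (𝒳 → Bool)) (d : ℕ) (δ K : ℝ) {T : ℕ}
    (S : Sample 𝒳 T) : Set ℕ :=
  {m | 1 ≤ m ∧ m ≤ T - 1 ∧ ∃ h ∈ C, maxRatio d δ S m h < K}

/-- A deterministic learning algorithm: at each time `T` it maps the observations made before time
`T` to a classifier. -/
abbrev Learner (𝒳 : Type*) : Type _ := (T : ℕ) → Sample 𝒳 T → 𝒳 → Bool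

/-- `A` is the adaptive algorithm (with some rule for breaking ties in the `argmin`): at each time
`T ≥ 2` it takes the largest admissible window length `m̂` and returns a member of `C` that
minimizes `maxRatio` over the window of length `m̂`. -/
def IsAdaptiveAlgorithm {𝒳 : Type*} (C : Set (𝒳 → Bool)) (d : ℕ) (δ K : ℝ)
    (A : Learner 𝒳) : Prop :=
  ∀ T : ℕ, 2 ≤ T → ∀ S : Sample 𝒳 T,
    ∃ mhat : ℕ, IsGreatest (admissibleWindows C d δ K S) mhat ∧
      A T S ∈ C ∧ IsMinOn (maxRatio d δ S mhat) C (A T S)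

/-- The observations `(X_t, h*_t(X_t))`, `1 ≤ t ≤ T - 1`, made before time `T`. -/
def observations {𝒳 Ω : Type*} (X : ℕ → Ω → 𝒳) (hstar : ℕ → 𝒳 → Bool) (T : ℕ) (ω : Ω) :
    Sample 𝒳 T :=
  fun t => (X t ω, hstar t (X t ω))

/-- `(1/m) ∑_{i=T-m}^{T-1} ∑_{j=i+1}^{T} Δ_j + (d Log(m/d) + Log(1/δ)) / m`. -/
def windowBound (d : ℕ) (δ : ℝ) (Δ : ℕ → ℝ) (T m : ℕ) : ℝ :=
  (1 / (m : ℝ)) * ∑ i ∈ Finset.Icc (T - m) (T - 1), ∑ j ∈ Finset.Icc (i + 1) T, Δ j +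
    complexity d δ m / m

end DriftLearning

end

/-!
The error bound needs uniform convergence over the class only on one window, whose length `M` is
not random. The average drift over a window increases with its length, while `complexity / m`
decreases, so there is a longest window on which the drift does not exceed the complexity. For this
`M`, the quantity `complexity M / (2 * M)` is a lower bound for the error bound of every window
(`exists_balanced_window`), and it remains to show that the error of the output is
`O(complexity M / M)`.

On each window of length `m ≤ M` the current target `h*_T` makes on average at most `complexity m`
mistakes. By a Chernoff bound (`chernoff_count`, `measureReal_threshold_le`) and a union bound over
`m`, which is affordable because `complexity m ≥ log m + log (1 / δ)`, it stays below the threshold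
`5 * complexity m` on all these windows with probability at least `1 - δ / 2`. Then the window
chosen by the algorithm has length at least `M`, so that its output also makes fewer than
`5 * complexity M` mistakes on the last `M` observations, and hence disagrees there with `h*_T` at
most `10 * complexity M` times (`card_disagree_le`).

The disagreements with `h*_T` are now counted on an independent sample with a fixed target, and the
relative deviation bound of Vapnik and Chervonenkis (`measureReal_exists_deviation_le`) shows that
with probability at least `1 - δ / 2` every such classifier has error less than
`80 * complexity M / M`. It is proved by symmetrization. For a labelling of a double sample with `a`
errors in the first half and `b` in the second, the weight `exp (b / 4 - a / 2)` has average at most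
`1` under random exchanges of the two halves (`sum_weight_swapHalves_le`), so its sum over all
realized labellings is on average at most their number, which the Sauer-Shelah lemma controls; but
the weight of a labelling with `a` small and `b` large is huge.

The output of the algorithm need not depend measurably on the observations, and the events
quantifying over the class need not be measurable: the bounds are for outer measures, and measurable
supersets are taken where Fubini's theorem or the final event needs them. The measurability assumption on the class enters only through the
expected number of realized labellings (`sum_measureReal_realization_le`).
-/

namespace DriftLearning

/-! ### The complexity term -/

lemma exp_neg_le {x : ℝ} (hx : -1 < x) : Real.exp (-x) ≤ (x + 1)⁻¹ := by
  rw [Real.exp_neg]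
  exact inv_anti₀ (by linarith) (Real.add_one_le_exp x)

lemma one_le_Log (x : ℝ) : 1 ≤ Log x := by
  rw [Log, Real.le_log_iff_exp_le (lt_max_of_lt_right (Real.exp_pos 1))]
  exact le_max_right _ _

lemma Log_mono {x y : ℝ} (h : x ≤ y) : Log x ≤ Log y :=
  Real.log_le_log (lt_max_of_lt_right (Real.exp_pos 1)) (max_le_max_right _ h)

lemma log_le_Log {x : ℝ} (hx : 0 < x) : Real.log x ≤ Log x :=
  Real.log_le_log hx (le_max_left _ _)

lemma exp_Log (x : ℝ) : Real.exp (Log x) = max x (Real.exp 1) :=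
  Real.exp_log (lt_max_of_lt_right (Real.exp_pos 1))

lemma Log_mul_le {r x : ℝ} (hr : 1 ≤ r) : Log (r * x) ≤ r * Log x := by
  have hpos : 0 < max x (Real.exp 1) := lt_max_of_lt_right (Real.exp_pos 1)
  have h1 : max (r * x) (Real.exp 1) ≤ r * max x (Real.exp 1) :=
    max_le (by gcongr; exact le_max_left _ _)
      ((le_max_right x _).trans (le_mul_of_one_le_left hpos.le hr))
  have h2 : Log (r * x) ≤ Real.log r + Log x := by
    rw [Log, Log, ← Real.log_mul (by positivity) hpos.ne']
    exact Real.log_le_log (lt_max_of_lt_right (Real.exp_pos 1)) h1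
  have h3 := Real.log_le_sub_one_of_pos (show 0 < r by linarith)
  nlinarith [one_le_Log x]

lemma two_le_complexity {d : ℕ} (hd : 1 ≤ d) (δ : ℝ) (m : ℕ) : 2 ≤ complexity d δ m := by
  have h1 := one_le_Log ((m : ℝ) / d)
  have h2 := one_le_Log (1 / δ)
  have h3 : (1 : ℝ) ≤ d := by exact_mod_cast hd
  rw [complexity]
  nlinarith

lemma complexity_mono (d : ℕ) (δ : ℝ) {m n : ℕ} (h : m ≤ n) :
    complexity d δ m ≤ complexity d δ n := by
  unfold complexity
  gcongr
  exact Log_mono (by gcongr)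

lemma complexity_div_anti (d : ℕ) (δ : ℝ) {m n : ℕ} (hm : 1 ≤ m) (h : m ≤ n) :
    complexity d δ n / n ≤ complexity d δ m / m := by
  have hm0 : (0 : ℝ) < m := by exact_mod_cast hm
  have hmn : (m : ℝ) ≤ n := by exact_mod_cast h
  have hn0 : (0 : ℝ) < n := hm0.trans_le hmn
  have hr : (1 : ℝ) ≤ n / m := (one_le_div hm0).2 hmn
  have key : complexity d δ n ≤ n / m * complexity d δ m := by
    have h1 : Log ((n : ℝ) / d) ≤ n / m * Log ((m : ℝ) / d) := by
      have := Log_mul_le (x := (m : ℝ) / d) hr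
      rwa [div_mul_div_comm, mul_comm (m : ℝ), mul_div_mul_right _ _ hm0.ne'] at this
    have h2 : Log (1 / δ) ≤ n / m * Log (1 / δ) :=
      le_mul_of_one_le_left (zero_le_one.trans (one_le_Log _)) hr
    unfold complexity
    calc _ ≤ d * (n / m * Log ((m : ℝ) / d)) + n / m * Log (1 / δ) := by gcongr
      _ = _ := by ring
  rw [div_le_iff₀ hn0]
  calc _ ≤ _ := key
    _ = _ := by ring

/-- The complexity term dominates `log m`; this pays for a union bound over window lengths. -/
lemma log_add_log_le_complexity {d : ℕ} (hd : 1 ≤ d) {δ : ℝ} (hδ : 0 < δ) {m : ℕ} (hm : 1 ≤ m) :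
    Real.log m + Real.log (1 / δ) ≤ complexity d δ m := by
  have hd0 : (0 : ℝ) < d := by exact_mod_cast hd
  have hd1 : (1 : ℝ) ≤ d := by exact_mod_cast hd
  have hm0 : (0 : ℝ) < m := by exact_mod_cast hm
  have h1 := one_le_Log ((m : ℝ) / d)
  have h2 : Real.log m - Real.log d ≤ Log ((m : ℝ) / d) := by
    rw [← Real.log_div hm0.ne' hd0.ne']
    exact log_le_Log (by positivity)
  have h3 := Real.log_le_sub_one_of_pos hd0
  have h4 := log_le_Log (show 0 < 1 / δ by positivity)
  unfold complexity
  nlinarith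

/-! ### The growth function -/

/-- The Sauer-Shelah bound for a double sample in terms of the complexity term, from the binomial
theorem for `(1 + 1 / u) ^ (2 * m)` with `u = max (m / d) e`. -/
lemma sum_choose_le_exp {d : ℕ} (hd : 1 ≤ d) (m : ℕ) :
    (∑ k ∈ Finset.Iic d, ((m + m).choose k : ℝ)) ≤ Real.exp (3 * (d * Log ((m : ℝ) / d))) := by
  have hd0 : (0 : ℝ) < d := by exact_mod_cast hd
  set u : ℝ := max ((m : ℝ) / d) (Real.exp 1) with hu
  have hu1 : 1 ≤ u := (Real.one_le_exp zero_le_one).trans (le_max_right _ _)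
  have hu0 : 0 < u := by linarith
  -- For `u ≥ 1` the sum is at most `u ^ d * (1 + 1 / u) ^ (2 * m)`.
  have h1 : (∑ k ∈ Finset.Iic d, ((m + m).choose k : ℝ)) ≤ u ^ d * (u⁻¹ + 1) ^ (m + m) := by
    calc (∑ k ∈ Finset.Iic d, ((m + m).choose k : ℝ))
        ≤ ∑ k ∈ Finset.Iic d, u ^ d * (u⁻¹ ^ k * ((m + m).choose k : ℝ)) := by
          refine Finset.sum_le_sum fun k hk => ?_
          rw [← mul_assoc]
          refine le_mul_of_one_le_left (by positivity) ?_
          rw [inv_pow, ← div_eq_mul_inv, one_le_div (by positivity)]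
          exact pow_le_pow_right₀ hu1 (Finset.mem_Iic.1 hk)
      _ ≤ ∑ k ∈ Finset.range (d + (m + m) + 1), u ^ d * (u⁻¹ ^ k * ((m + m).choose k : ℝ)) := by
          refine Finset.sum_le_sum_of_subset_of_nonneg (fun k hk => ?_)
            fun _ _ _ => by positivity
          have := Finset.mem_Iic.1 hk
          exact Finset.mem_range.2 (by omega)
      _ = ∑ k ∈ Finset.range (m + m + 1), u ^ d * (u⁻¹ ^ k * ((m + m).choose k : ℝ)) := by
          refine (Finset.sum_subset (fun k hk => ?_) fun k _ hk => ?_).symm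
          · have := Finset.mem_range.1 hk
            exact Finset.mem_range.2 (by omega)
          · rw [Finset.mem_range] at hk
            rw [Nat.choose_eq_zero_of_lt (by omega)]
            simp
      _ = _ := by
          rw [add_pow, Finset.mul_sum]
          simp
  have h2 : u ^ d = Real.exp (d * Log ((m : ℝ) / d)) := by
    rw [Real.exp_nat_mul, exp_Log]
  have h3 : (u⁻¹ + 1) ^ (m + m) ≤ Real.exp (2 * (d * Log ((m : ℝ) / d))) := by
    calc (u⁻¹ + 1) ^ (m + m) ≤ Real.exp u⁻¹ ^ (m + m) := by
          gcongr
          exact Real.add_one_le_exp _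
      _ = Real.exp (2 * (m * u⁻¹)) := by
          rw [← Real.exp_nat_mul]
          push_cast
          ring_nf
      _ ≤ _ := by
          have : (m : ℝ) * u⁻¹ ≤ d * 1 := by
            rw [mul_one, ← div_eq_mul_inv, div_le_iff₀ hu0, mul_comm, ← div_le_iff₀ hd0]
            exact le_max_left _ _
          refine Real.exp_le_exp.2 (mul_le_mul_of_nonneg_left (this.trans ?_) zero_le_two)
          gcongr
          exact one_le_Log _
  calc _ ≤ _ := h1
    _ ≤ Real.exp (d * Log ((m : ℝ) / d)) * Real.exp (2 * (d * Log ((m : ℝ) / d))) := by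
        rw [h2]; gcongr
    _ = _ := by rw [← Real.exp_add]; ring_nf

/-- The set of points `z` of `κ → 𝒳` on which some member of `C` realizes the labelling `y`. -/
def realization {𝒳 κ : Type*} (C : Set (𝒳 → Bool)) (y : κ → Bool) : Set (κ → 𝒳) :=
  {z | ∃ h ∈ C, ∀ i, h (z i) = y i}

open Classical in
/-- The **Sauer-Shelah lemma** for labellings of a family of points, repetitions allowed. -/
lemma card_realized_le {𝒳 κ : Type*} [Fintype κ] [DecidableEq κ] {C : Set (𝒳 → Bool)} {d : ℕ}
    (hC : ∀ s, Shatters C s → s.card ≤ d) (z : κ → 𝒳) :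
    (Finset.univ.filter fun y : κ → Bool => z ∈ realization C y).card ≤
      ∑ k ∈ Finset.Iic d, (Fintype.card κ).choose k := by
  set 𝒜 : Finset (Finset κ) :=
    (Finset.univ.filter fun y : κ → Bool => z ∈ realization C y).image
      (fun y => Finset.univ.filter fun i => y i = true) with h𝒜
  have hinj : Function.Injective
      (fun y : κ → Bool => Finset.univ.filter fun i => y i = true) := by
    intro y y' h
    ext i
    have := Finset.ext_iff.1 h i
    simpa using this
  have hvc : 𝒜.vcDim ≤ d := by
    refine Finset.sup_le fun s hs => ?_
    rw [Finset.mem_shatterer] at hs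
    -- A shattered set of indices carries distinct points, which `C` shatters.
    have hlab : ∀ t ⊆ s, ∃ h ∈ C, ∀ i ∈ s, h (z i) = true ↔ i ∈ t := by
      intro t ht
      obtain ⟨u, hu, hut⟩ := hs ht
      simp only [h𝒜, Finset.mem_image, Finset.mem_filter, Finset.mem_univ, true_and] at hu
      obtain ⟨y, ⟨h, hh, hy⟩, rfl⟩ := hu
      refine ⟨h, hh, fun i hi => ?_⟩
      rw [← hut, hy]
      simp [hi]
    have hzinj : Set.InjOn z s := by
      intro i hi j hj hij
      obtain ⟨h, -, hh⟩ := hlab {i} (by simpa using hi)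
      have h1 := (hh i hi).2 (by simp)
      rw [hij, hh j hj] at h1
      exact (Finset.mem_singleton.1 h1).symm
    rw [← Finset.card_image_of_injOn hzinj]
    refine hC _ fun f => ?_
    obtain ⟨h, hh, hy⟩ := hlab (s.filter fun i => f (z i) = true) (Finset.filter_subset _ _)
    refine ⟨h, hh, fun x hx => ?_⟩
    obtain ⟨i, hi, rfl⟩ := Finset.mem_image.1 hx
    have := hy i hi
    rw [Finset.mem_filter] at this
    rw [Bool.eq_iff_iff, this]
    exact ⟨fun h => h.2, fun h => ⟨hi, h⟩⟩
  rw [← Finset.card_image_of_injective _ hinj]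
  refine (Finset.card_le_card_shatterer 𝒜).trans (Finset.card_shatterer_le_sum_vcDim.trans ?_)
  exact Finset.sum_le_sum_of_subset (Finset.Iic_subset_Iic.2 hvc)

/-! ### Deviations of counts of independent events -/

/-- **Chernoff bound** for the number of indices `i` with `f i (x i) = true`, where the `x i` are
independent with law `P`.  Positive `l` bounds the upper tail and negative `l` the lower tail. -/
lemma chernoff_count {𝒳 ι : Type*} [MeasurableSpace 𝒳] [Fintype ι] (P : Measure 𝒳)
    [IsProbabilityMeasure P] (f : ι → 𝒳 → Bool) (hf : ∀ i, Measurable (f i)) (l a : ℝ) :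
    (Measure.pi fun _ : ι => P).real
        {x | a ≤ l * ((Finset.univ.filter fun i => f i (x i) = true).card : ℝ)} ≤
      Real.exp ((Real.exp l - 1) * (∑ i, P.real {y | f i y = true}) - a) := by
  set A : ι → Set 𝒳 := fun i => {y | f i y = true} with hAdef
  have hA : ∀ i, MeasurableSet (A i) := fun i => hf i (measurableSet_singleton true)
  set F : (ι → 𝒳) → ℝ := fun x => ∏ i, (1 + (A i).indicator (fun _ => Real.exp l - 1) (x i))
    with hF
  have hpt : ∀ x, F x =
      Real.exp (l * ((Finset.univ.filter fun i => f i (x i) = true).card : ℝ)) := by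
    intro x
    have h1 : l * ((Finset.univ.filter fun i => f i (x i) = true).card : ℝ) =
        ∑ i, if f i (x i) = true then l else 0 := by
      rw [Finset.sum_ite]
      simp [mul_comm]
    rw [h1, Real.exp_sum]
    refine Finset.prod_congr rfl fun i _ => ?_
    by_cases h : f i (x i) = true <;> simp [A, h]
  have hint : ∫ x, F x ∂(Measure.pi fun _ : ι => P) ≤
      Real.exp ((Real.exp l - 1) * ∑ i, P.real (A i)) := by
    rw [hF, integral_fintype_prod_eq_prod (fun i (y : 𝒳) =>
      1 + (A i).indicator (fun _ => Real.exp l - 1) y), Finset.mul_sum, Real.exp_sum]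
    have hval : ∀ i, ∫ y, (1 + (A i).indicator (fun _ => Real.exp l - 1) y) ∂P =
        (Real.exp l - 1) * P.real (A i) + 1 := by
      intro i
      rw [integral_add (integrable_const _) ((integrable_const _).indicator (hA i)),
        integral_indicator_const _ (hA i)]
      simp [mul_comm, add_comm]
    refine Finset.prod_le_prod (fun i _ => ?_) fun i _ => ?_
    · rw [hval]
      have h0 : 0 ≤ P.real (A i) := measureReal_nonneg
      have h1 : P.real (A i) ≤ 1 := measureReal_le_one
      nlinarith [Real.exp_pos l]
    · rw [hval]
      exact Real.add_one_le_exp _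
  have hmeas : Measurable F := by
    refine Finset.measurable_prod _ fun i _ => ?_
    exact measurable_const.add ((measurable_const.indicator (hA i)).comp (measurable_pi_apply i))
  have hbd : ∀ x, ‖F x‖ ≤ Real.exp (|l| * Fintype.card ι) := by
    intro x
    rw [hpt, Real.norm_eq_abs, Real.abs_exp]
    gcongr
    · exact le_abs_self l
    · exact Finset.card_le_univ _
  have hFint : Integrable F (Measure.pi fun _ : ι => P) :=
    Integrable.of_bound hmeas.aestronglyMeasurable _ (Filter.Eventually.of_forall hbd)
  have hmarkov := mul_meas_ge_le_integral_of_nonneg (μ := Measure.pi fun _ : ι => P)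
    (Filter.Eventually.of_forall fun x => (by rw [hpt]; exact (Real.exp_pos _).le : 0 ≤ F x))
    hFint (Real.exp a)
  have hset : {x | a ≤ l * ((Finset.univ.filter fun i => f i (x i) = true).card : ℝ)} =
      {x | Real.exp a ≤ F x} := by
    ext x
    simp [hpt]
  rw [hset, Real.exp_sub, le_div_iff₀ (Real.exp_pos a), mul_comm]
  exact hmarkov.trans hint

/-! ### Exchanging the two halves of a double sample -/

/-- Exchange the points `inl i` and `inr i` for those `i` with `σ i = true`. -/
def swapHalves {ι : Type*} (σ : ι → Bool) : Equiv.Perm (ι ⊕ ι) :=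
  Function.Involutive.toPerm
    (Sum.elim (fun i => if σ i then Sum.inr i else Sum.inl i)
      (fun i => if σ i then Sum.inl i else Sum.inr i))
    (by rintro (i | i) <;> by_cases h : σ i <;> simp [h])

/-- The exponential weight of a labelling of a double sample, small when the label `true` is
frequent on the first half and large when it is frequent on the second half. -/
noncomputable def weight {ι : Type*} [Fintype ι] (y : ι ⊕ ι → Bool) : ℝ :=
  ∏ i, Real.exp ((if y (Sum.inr i) then 1 / 4 else 0) - (if y (Sum.inl i) then 1 / 2 else 0))

lemma weight_eq {ι : Type*} [Fintype ι] (y : ι ⊕ ι → Bool) :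
    weight y = Real.exp (((Finset.univ.filter fun i => y (Sum.inr i) = true).card : ℝ) / 4 -
      ((Finset.univ.filter fun i => y (Sum.inl i) = true).card : ℝ) / 2) := by
  rw [weight, ← Real.exp_sum, Finset.sum_sub_distrib, Finset.sum_ite, Finset.sum_ite]
  simp [div_eq_mul_inv]

/-- The average of the weight over random exchanges is at most `1`: the exponents are such that
`(exp (1 / 4) + exp (-1 / 2)) / 2 ≤ 1`. -/
lemma sum_weight_swapHalves_le {ι : Type*} [Fintype ι] [DecidableEq ι] (y : ι ⊕ ι → Bool) :
    ∑ σ : ι → Bool, weight (y ∘ swapHalves σ) ≤ Fintype.card (ι → Bool) := by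
  have hq : Real.exp (1 / 4) ≤ 4 / 3 := by
    simpa using (exp_neg_le (x := -(1 / 4)) (by norm_num)).trans_eq (by norm_num)
  have hh : Real.exp (-(1 / 2)) ≤ 2 / 3 := (exp_neg_le (by norm_num)).trans_eq (by norm_num)
  have hqh : Real.exp (-(1 / 4)) ≤ 1 := Real.exp_le_one_iff.2 (by norm_num)
  let f : ι → Bool → ℝ := fun i b => if b then
      Real.exp ((if y (Sum.inl i) then 1 / 4 else 0) - (if y (Sum.inr i) then 1 / 2 else 0))
    else Real.exp ((if y (Sum.inr i) then 1 / 4 else 0) - (if y (Sum.inl i) then 1 / 2 else 0))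
  have hprod : ∀ σ : ι → Bool, weight (y ∘ swapHalves σ) = ∏ i, f i (σ i) := by
    intro σ
    refine Finset.prod_congr rfl fun i _ => ?_
    have hl : swapHalves σ (Sum.inl i) = if σ i then Sum.inr i else Sum.inl i := rfl
    have hr : swapHalves σ (Sum.inr i) = if σ i then Sum.inl i else Sum.inr i := rfl
    cases h : σ i <;> simp [f, hl, hr, h]
  have hsum := Finset.prod_univ_sum (fun _ : ι => (Finset.univ : Finset Bool)) f
  rw [Fintype.piFinset_univ] at hsum
  have hcard : (Fintype.card (ι → Bool) : ℝ) = ∏ _i : ι, (2 : ℝ) := by simp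
  rw [hcard, Finset.sum_congr rfl fun σ _ => hprod σ, ← hsum]
  refine Finset.prod_le_prod (fun i _ => ?_) fun i _ => ?_
  · exact Finset.sum_nonneg fun b _ => by cases b <;> simp [f, Real.exp_nonneg]
  · rw [Fintype.sum_bool]
    simp only [f]
    cases y (Sum.inl i) <;> cases y (Sum.inr i) <;> norm_num <;> linarith

section Realization

variable {𝒳 : Type*} [MeasurableSpace 𝒳] {C : Set (𝒳 → Bool)} {P : Measure 𝒳}
  [IsProbabilityMeasure P]

lemma MeasurableRealization.nullMeasurableSet (hC : MeasurableRealization C P) {κ : Type*}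
    [Fintype κ] (y : κ → Bool) :
    NullMeasurableSet (realization C y) (Measure.pi fun _ : κ => P) := by
  have e := Fintype.equivFin κ
  have hmp := measurePreserving_arrowCongr' (fun _ : κ => P) (fun _ : Fin (Fintype.card κ) => P)
    e (MeasurableEquiv.refl 𝒳) (fun _ => MeasurePreserving.id P)
  have h := (hC _ (y ∘ e.symm)).preimage hmp.quasiMeasurePreserving
  convert h using 1
  ext z
  simp only [realization, Set.mem_ofPred_eq, Set.mem_preimage, Function.comp]
  refine exists_congr fun h => and_congr_right fun _ => ?_
  refine e.forall_congr fun i => ?_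
  have hi : MeasurableEquiv.arrowCongr' e (MeasurableEquiv.refl 𝒳) z (e i) = z i :=
    congrArg z (e.symm_apply_apply i)
  rw [hi, e.symm_apply_apply]

lemma measureReal_realization_comp {κ : Type*} [Fintype κ] (e : Equiv.Perm κ) (y : κ → Bool) :
    (Measure.pi fun _ : κ => P).real (realization C (y ∘ e)) =
      (Measure.pi fun _ : κ => P).real (realization C y) := by
  have hmp := measurePreserving_arrowCongr' (fun _ : κ => P) (fun _ : κ => P)
    e (MeasurableEquiv.refl 𝒳) (fun _ => MeasurePreserving.id P)
  have h := hmp.measure_preimage_equiv (realization C y)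
  rw [measureReal_def, measureReal_def, ← h]
  congr 2
  ext z
  simp only [realization, Set.mem_ofPred_eq, Set.mem_preimage, Function.comp]
  refine exists_congr fun h => and_congr_right fun _ => ?_
  refine e.forall_congr fun i => ?_
  have hi : MeasurableEquiv.arrowCongr' e (MeasurableEquiv.refl 𝒳) z (e i) = z i :=
    congrArg z (e.symm_apply_apply i)
  rw [hi]

/-- The expected number of labellings realized on a random sample, by the Sauer-Shelah lemma. -/
lemma sum_measureReal_realization_le {d : ℕ} (hC : MeasurableRealization C P)
    (hd : ∀ s, Shatters C s → s.card ≤ d) (κ : Type*) [Fintype κ] [DecidableEq κ] :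
    ∑ y : κ → Bool, (Measure.pi fun _ : κ => P).real (realization C y) ≤
      ∑ k ∈ Finset.Iic d, ((Fintype.card κ).choose k : ℝ) := by
  classical
  have h1 : ∀ y : κ → Bool, (Measure.pi fun _ : κ => P).real (realization C y) =
      ∫ z, (realization C y).indicator (fun _ => (1 : ℝ)) z ∂(Measure.pi fun _ : κ => P) := by
    intro y
    rw [integral_indicator₀ (hC.nullMeasurableSet y)]
    simp
  rw [Finset.sum_congr rfl fun y _ => h1 y, ← integral_finsetSum]
  · refine (integral_mono_of_nonneg (g := fun _ => ∑ k ∈ Finset.Iic d,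
      ((Fintype.card κ).choose k : ℝ)) (Filter.Eventually.of_forall fun z => ?_)
      (integrable_const _) (Filter.Eventually.of_forall fun z => ?_)).trans (by simp)
    · exact Finset.sum_nonneg fun y _ => Set.indicator_nonneg (fun _ _ => zero_le_one) _
    · have := card_realized_le hd z
      simp only [Set.indicator_apply, Finset.sum_boole]
      exact_mod_cast this
  · exact fun y _ => (integrable_const _).indicator₀ (hC.nullMeasurableSet y)

/-- Symmetrization: independent exchanges leave the law of a double sample unchanged, so the
weight may be replaced by its average over exchanges. -/
lemma sum_measureReal_realization_mul_weight_le {d : ℕ} (hC : MeasurableRealization C P)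
    (hd : ∀ s, Shatters C s → s.card ≤ d) (ι : Type*) [Fintype ι] [DecidableEq ι] :
    ∑ y : ι ⊕ ι → Bool, (Measure.pi fun _ : ι ⊕ ι => P).real (realization C y) * weight y ≤
      ∑ k ∈ Finset.Iic d, ((Fintype.card ι + Fintype.card ι).choose k : ℝ) := by
  set p : (ι ⊕ ι → Bool) → ℝ := fun y => (Measure.pi fun _ : ι ⊕ ι => P).real (realization C y)
    with hp
  have hswap : ∀ σ : ι → Bool, ∑ y, p y * weight (y ∘ swapHalves σ) = ∑ y, p y * weight y := by
    intro σ
    refine Fintype.sum_equiv ((swapHalves σ).symm.arrowCongr (Equiv.refl Bool)) _ _ fun y => ?_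
    have : (swapHalves σ).symm.arrowCongr (Equiv.refl Bool) y = y ∘ swapHalves σ := rfl
    rw [this, hp]
    simp only
    rw [measureReal_realization_comp]
  have hN : (0 : ℝ) < Fintype.card (ι → Bool) := by exact_mod_cast Fintype.card_pos
  have key : Fintype.card (ι → Bool) * ∑ y, p y * weight y ≤
      Fintype.card (ι → Bool) * ∑ y, p y := by
    calc Fintype.card (ι → Bool) * ∑ y, p y * weight y
        = ∑ σ : ι → Bool, ∑ y, p y * weight (y ∘ swapHalves σ) := by
          rw [Finset.sum_congr rfl fun σ _ => hswap σ]
          simp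
      _ = ∑ y, p y * ∑ σ : ι → Bool, weight (y ∘ swapHalves σ) := by
          rw [Finset.sum_comm]
          simp_rw [Finset.mul_sum]
      _ ≤ ∑ y, p y * Fintype.card (ι → Bool) := by
          gcongr with y
          exact sum_weight_swapHalves_le y
      _ = _ := by rw [← Finset.sum_mul, mul_comm]
  have h2 := sum_measureReal_realization_le hC hd (ι ⊕ ι)
  rw [Fintype.card_sum] at h2
  exact (le_of_mul_le_mul_left key hN).trans h2

end Realization

section Uniform

variable {𝒳 : Type*} [MeasurableSpace 𝒳] {C : Set (𝒳 → Bool)} {P : Measure 𝒳}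
  [IsProbabilityMeasure P]

/-! ### Uniform relative deviations over a class of finite VC dimension -/

/-- An event of probability at least `ε` is with probability at least `1 / 2` observed on half of
its expected number of occasions. -/
lemma half_le_measureReal_ghost {ι : Type*} [Fintype ι] {h : 𝒳 → Bool} (hh : Measurable h) {ε : ℝ}
    (hε : 12 ≤ Fintype.card ι * ε) (hP : ε ≤ P.real {x | h x = true}) :
    1 / 2 ≤ (Measure.pi fun _ : ι => P).real
      {x | Fintype.card ι * ε / 2 ≤ ((Finset.univ.filter fun i => h (x i) = true).card : ℝ)} := by
  set n : ℝ := (Fintype.card ι : ℝ) with hn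
  have hn0 : 0 ≤ n := Nat.cast_nonneg _
  have hnp : 12 ≤ n * P.real {x | h x = true} := hε.trans (by gcongr)
  have hc := chernoff_count (ι := ι) P (fun _ => h) (fun _ => hh) (-(1 / 2))
    (-(n * P.real {x | h x = true} / 4))
  have hexp : Real.exp (-(1 / 2)) ≤ 2 / 3 :=
    (exp_neg_le (by norm_num)).trans_eq (by norm_num)
  have hexp1 : Real.exp (-1) ≤ 1 / 2 := (exp_neg_le (by norm_num)).trans_eq (by norm_num)
  have hsum : ∑ _i : ι, P.real {x | h x = true} = n * P.real {x | h x = true} := by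
    simp [hn]
  rw [hsum] at hc
  have hle : (Real.exp (-(1 / 2)) - 1) * (n * P.real {x | h x = true}) -
      -(n * P.real {x | h x = true} / 4) ≤ -1 := by nlinarith
  have hsmall := hc.trans ((Real.exp_le_exp.2 hle).trans hexp1)
  have hcover : (1 : ℝ) ≤ (Measure.pi fun _ : ι => P).real
      ({x | n * ε / 2 ≤ ((Finset.univ.filter fun i => h (x i) = true).card : ℝ)} ∪
        {x | -(n * P.real {x | h x = true} / 4) ≤ -(1 / 2) *
          ((Finset.univ.filter fun i => h (x i) = true).card : ℝ)}) := by
    refine (probReal_univ (μ := Measure.pi fun _ : ι => P)).ge.trans ?_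
    refine measureReal_mono fun x _ => ?_
    simp only [Set.mem_union, Set.mem_ofPred_eq]
    by_contra! hcon
    have : n * ε ≤ n * P.real {x | h x = true} := by gcongr
    linarith [hcon.1, hcon.2]
  linarith [hcover.trans (measureReal_union_le _ _)]

/-- If some member of `C` has few labels `true` on a sample but a large probability of the label
`true`, then a second, independent sample shows many labels `true` with probability at least
`1 / 2`.  So the probability of the former is at most twice that of the corresponding event on a
double sample, which the weights control. -/
lemma measureReal_exists_deviation_le {d : ℕ} (hmeas : ∀ h ∈ C, Measurable h)
    (hC : MeasurableRealization C P) (hd : ∀ s, Shatters C s → s.card ≤ d)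
    (ι : Type*) [Fintype ι] [DecidableEq ι] {ε : ℝ} (k : ℝ) (hε : 12 ≤ Fintype.card ι * ε) :
    (Measure.pi fun _ : ι => P).real
        {x | ∃ h ∈ C, ((Finset.univ.filter fun i => h (x i) = true).card : ℝ) ≤ k ∧
          ε ≤ P.real {x | h x = true}} ≤
      2 * (Real.exp (k / 2 - Fintype.card ι * ε / 8) *
        ∑ j ∈ Finset.Iic d, ((Fintype.card ι + Fintype.card ι).choose j : ℝ)) := by
  classical
  set n : ℝ := (Fintype.card ι : ℝ) with hn
  set ν : Measure (ι → 𝒳) := Measure.pi fun _ : ι => P with hν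
  set Q : Set (ι ⊕ ι → 𝒳) := {z | ∃ h ∈ C,
    ((Finset.univ.filter fun i => h (z (Sum.inl i)) = true).card : ℝ) ≤ k ∧
    n * ε / 2 ≤ ((Finset.univ.filter fun i => h (z (Sum.inr i)) = true).card : ℝ)} with hQ
  set B : Finset (ι ⊕ ι → Bool) := Finset.univ.filter fun y =>
    ((Finset.univ.filter fun i => y (Sum.inl i) = true).card : ℝ) ≤ k ∧
    n * ε / 2 ≤ ((Finset.univ.filter fun i => y (Sum.inr i) = true).card : ℝ) with hB
  have hQle : (Measure.pi fun _ : ι ⊕ ι => P).real Q ≤ Real.exp (k / 2 - n * ε / 8) *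
      ∑ j ∈ Finset.Iic d, ((Fintype.card ι + Fintype.card ι).choose j : ℝ) := by
    have hsub : Q ⊆ ⋃ y ∈ B, realization C y := by
      rintro z ⟨h, hh, h1, h2⟩
      simp only [Set.mem_iUnion]
      exact ⟨fun i => h (z i), by simpa [hB] using ⟨h1, h2⟩, h, hh, fun _ => rfl⟩
    calc (Measure.pi fun _ : ι ⊕ ι => P).real Q
        ≤ (Measure.pi fun _ : ι ⊕ ι => P).real (⋃ y ∈ B, realization C y) :=
          measureReal_mono hsub (measure_ne_top _ _)
      _ ≤ ∑ y ∈ B, (Measure.pi fun _ : ι ⊕ ι => P).real (realization C y) :=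
          measureReal_biUnion_finset_le _ _
      _ ≤ ∑ y ∈ B, Real.exp (k / 2 - n * ε / 8) *
            ((Measure.pi fun _ : ι ⊕ ι => P).real (realization C y) * weight y) := by
          refine Finset.sum_le_sum fun y hy => ?_
          simp only [hB, Finset.mem_filter, Finset.mem_univ, true_and] at hy
          rw [weight_eq, mul_left_comm, ← Real.exp_add]
          refine le_mul_of_one_le_right measureReal_nonneg (Real.one_le_exp ?_)
          linarith [hy.1, hy.2]
      _ ≤ ∑ y, Real.exp (k / 2 - n * ε / 8) *
            ((Measure.pi fun _ : ι ⊕ ι => P).real (realization C y) * weight y) := by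
          refine Finset.sum_le_sum_of_subset_of_nonneg (Finset.subset_univ _) fun y _ _ => ?_
          rw [weight_eq]
          positivity
      _ ≤ _ := by
          rw [← Finset.mul_sum]
          gcongr
          exact sum_measureReal_realization_mul_weight_le hC hd ι
  -- The event on the double sample is replaced by a measurable superset of the same measure.
  set e := MeasurableEquiv.sumPiEquivProdPi (fun _ : ι ⊕ ι => 𝒳) with he
  have hmp : MeasurePreserving e (Measure.pi fun _ : ι ⊕ ι => P) (ν.prod ν) :=
    measurePreserving_sumPiEquivProdPi fun _ : ι ⊕ ι => P
  set V : Set ((ι → 𝒳) × (ι → 𝒳)) := toMeasurable (ν.prod ν) (e.symm ⁻¹' Q) with hV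
  have hVQ : (ν.prod ν) V = (Measure.pi fun _ : ι ⊕ ι => P) Q := by
    rw [hV, measure_toMeasurable, ← hmp.measure_preimage_equiv, ← Set.preimage_comp]
    simp
  have hVm : MeasurableSet V := measurableSet_toMeasurable _ _
  have hsub : {x | ∃ h ∈ C, ((Finset.univ.filter fun i => h (x i) = true).card : ℝ) ≤ k ∧
      ε ≤ P.real {x | h x = true}} ⊆ {x | 2⁻¹ ≤ ν (Prod.mk x ⁻¹' V)} := by
    rintro x ⟨h, hh, h1, h2⟩
    have hhalf := half_le_measureReal_ghost (ι := ι) (hmeas h hh) hε h2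
    have hmono : ν.real
        {x | Fintype.card ι * ε / 2 ≤ ((Finset.univ.filter fun i => h (x i) = true).card : ℝ)} ≤
        ν.real (Prod.mk x ⁻¹' V) := by
      refine measureReal_mono fun x' hx' => ?_
      refine subset_toMeasurable _ _ ?_
      exact ⟨h, hh, h1, hx'⟩
    have := hhalf.trans hmono
    rw [Set.mem_ofPred_eq, ← ENNReal.ofReal_toReal (measure_ne_top ν (Prod.mk x ⁻¹' V))]
    rw [← ENNReal.ofReal_ofNat, ← ENNReal.ofReal_inv_of_pos two_pos]
    refine ENNReal.ofReal_le_ofReal ?_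
    rw [← measureReal_def]
    linarith
  have hmarkov := mul_meas_ge_le_lintegral (μ := ν) (measurable_measure_prodMk_left (ν := ν) hVm)
    2⁻¹
  rw [← Measure.prod_apply hVm, hVQ] at hmarkov
  have hreal := ENNReal.toReal_mono (measure_ne_top _ _) hmarkov
  rw [ENNReal.toReal_mul, ENNReal.toReal_inv, ← measureReal_def, ← measureReal_def] at hreal
  have := measureReal_mono (μ := ν) hsub
  norm_num at hreal
  linarith

end Uniform

/-! ### Error patterns relative to a fixed target -/

/-- The indicators of the error regions `{x | h x ≠ g x}` of the members `h` of `C` relative to the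
target `g`. -/
def errorClass {𝒳 : Type*} (C : Set (𝒳 → Bool)) (g : 𝒳 → Bool) : Set (𝒳 → Bool) :=
  (fun h x => h x ^^ g x) '' C

lemma shatters_of_shatters_errorClass {𝒳 : Type*} {C : Set (𝒳 → Bool)} {g : 𝒳 → Bool}
    {s : Finset 𝒳} (hs : Shatters (errorClass C g) s) : Shatters C s := by
  intro f
  obtain ⟨-, ⟨h, hh, rfl⟩, hf⟩ := hs fun x => f x ^^ g x
  exact ⟨h, hh, fun x hx => by simpa using hf x hx⟩

lemma MeasurableRealization.errorClass {𝒳 : Type*} [MeasurableSpace 𝒳] {C : Set (𝒳 → Bool)}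
    {P : Measure 𝒳} (hC : MeasurableRealization C P) {g : 𝒳 → Bool} (hg : Measurable g) :
    MeasurableRealization (errorClass C g) P := by
  intro n y
  have heq : {x : Fin n → 𝒳 | ∃ h ∈ DriftLearning.errorClass C g, ∀ i, h (x i) = y i} =
      ⋃ y' : Fin n → Bool, {x : Fin n → 𝒳 | ∃ h ∈ C, ∀ i, h (x i) = y' i} ∩
        {x | ∀ i, g (x i) = (y' i ^^ y i)} := by
    ext x
    simp only [DriftLearning.errorClass, Set.mem_ofPred_eq, Set.exists_mem_image, Set.mem_iUnion,
      Set.mem_inter_iff]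
    constructor
    · rintro ⟨h, hh, hy⟩
      exact ⟨fun i => h (x i), ⟨h, hh, fun _ => rfl⟩, fun i => by simp [← hy]⟩
    · rintro ⟨y', ⟨h, hh, hy'⟩, hy⟩
      exact ⟨h, hh, fun i => by simp [hy', hy]⟩
  rw [heq]
  refine NullMeasurableSet.iUnion fun y' => (hC n y').inter (MeasurableSet.nullMeasurableSet ?_)
  rw [Set.ofPred_forall]
  exact MeasurableSet.iInter fun i =>
    (hg.comp (measurable_pi_apply i)) (measurableSet_singleton _)

lemma disagreement_eq {𝒳 : Type*} [MeasurableSpace 𝒳] (P : Measure 𝒳) (h g : 𝒳 → Bool) :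
    disagreement P h g = P.real {x | (h x ^^ g x) = true} := by
  simp [disagreement]

/-! ### Drift and the choice of the window -/

lemma disagreement_triangle {𝒳 : Type*} [MeasurableSpace 𝒳] (P : Measure 𝒳)
    [IsProbabilityMeasure P] (f g h : 𝒳 → Bool) :
    disagreement P f h ≤ disagreement P f g + disagreement P g h := by
  refine (measureReal_mono fun x hx => ?_).trans (measureReal_union_le _ _)
  by_contra! hcon
  simp only [Set.mem_union, Set.mem_ofPred_eq, not_or, not_not] at hcon hx
  exact hx (hcon.1.trans hcon.2)

lemma disagreement_le_sum_drift {𝒳 : Type*} [MeasurableSpace 𝒳] {C : Set (𝒳 → Bool)}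
    {P : Measure 𝒳} [IsProbabilityMeasure P] {Δ : ℕ → ℝ} {hstar : ℕ → 𝒳 → Bool}
    (hS : hstar ∈ driftSet C P Δ) {i T : ℕ} (hi : 1 ≤ i) (hiT : i ≤ T) :
    disagreement P (hstar T) (hstar i) ≤ ∑ j ∈ Finset.Icc (i + 1) T, Δ j := by
  have hsymm : ∀ f g : 𝒳 → Bool, disagreement P f g = disagreement P g f := fun f g => by
    simp [disagreement, ne_comm]
  induction T, hiT using Nat.le_induction with
  | base => simp [disagreement]
  | succ T hT ih =>
    rw [Finset.sum_Icc_succ_top (by omega)]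
    have h1 := disagreement_triangle P (hstar (T + 1)) (hstar T) (hstar i)
    have h2 := (hS T (hi.trans hT)).2
    rw [hsymm] at h2
    linarith

/-- The accumulated drift over the window of length `m`. -/
def windowDrift (Δ : ℕ → ℝ) (T m : ℕ) : ℝ :=
  ∑ i ∈ Finset.Icc (T - m) (T - 1), ∑ j ∈ Finset.Icc (i + 1) T, Δ j

/-- The average drift grows with the window, because older targets have drifted further. -/
lemma windowDrift_div_mono {Δ : ℕ → ℝ} (hΔ : ∀ t, 2 ≤ t → 0 ≤ Δ t) {T m n : ℕ} (hm : 1 ≤ m)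
    (hmn : m ≤ n) (hn : n ≤ T - 1) : windowDrift Δ T m / m ≤ windowDrift Δ T n / n := by
  induction n, hmn using Nat.le_induction with
  | base => rfl
  | succ n hmn ih =>
    refine (ih (by omega)).trans ?_
    set D : ℕ → ℝ := fun i => ∑ j ∈ Finset.Icc (i + 1) T, Δ j with hD
    have hstep : windowDrift Δ T (n + 1) = D (T - (n + 1)) + windowDrift Δ T n := by
      have h1 : Finset.Icc (T - (n + 1)) (T - 1) =
          insert (T - (n + 1)) (Finset.Icc (T - n) (T - 1)) := by
        ext i
        simp only [Finset.mem_Icc, Finset.mem_insert]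
        omega
      rw [windowDrift, h1, Finset.sum_insert (by simp only [Finset.mem_Icc]; omega)]
      rfl
    have hle : windowDrift Δ T n ≤ n * D (T - (n + 1)) := by
      have hcard : (Finset.Icc (T - n) (T - 1)).card = n := by
        rw [Nat.card_Icc]
        omega
      have := Finset.sum_le_card_nsmul (Finset.Icc (T - n) (T - 1)) D (D (T - (n + 1)))
        fun i hi => by
          rw [Finset.mem_Icc] at hi
          refine Finset.sum_le_sum_of_subset_of_nonneg
            (Finset.Icc_subset_Icc_left (by omega)) fun j hj _ => hΔ j ?_
          rw [Finset.mem_Icc] at hj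
          omega
      rwa [hcard, nsmul_eq_mul] at this
    have hn0 : (0 : ℝ) < n := by exact_mod_cast hm.trans hmn
    rw [hstep, div_le_div_iff₀ hn0 (by positivity)]
    push_cast
    linarith

/-- There is a window which balances drift and complexity; up to the factor `2` its complexity
term alone is a lower bound for the error bound of every window. -/
lemma exists_balanced_window {d : ℕ} (hd : 1 ≤ d) (δ : ℝ) {Δ : ℕ → ℝ}
    (hΔ : ∀ t, 2 ≤ t → Δ t ∈ Set.Icc (0 : ℝ) 1) {T : ℕ} (hT : 2 ≤ T) :
    ∃ M, 1 ≤ M ∧ M ≤ T - 1 ∧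
      (∀ m, 1 ≤ m → m ≤ M → windowDrift Δ T m ≤ complexity d δ m) ∧
      ∀ m, 1 ≤ m → m ≤ T - 1 → complexity d δ M / (2 * M) ≤ windowBound d δ Δ T m := by
  classical
  have hmono {m n : ℕ} := windowDrift_div_mono (fun t ht => (hΔ t ht).1) (T := T) (m := m) (n := n)
  set s := (Finset.Icc 1 (T - 1)).filter fun m => windowDrift Δ T m ≤ complexity d δ m with hs
  have h1 : 1 ∈ s := by
    refine Finset.mem_filter.2 ⟨Finset.mem_Icc.2 ⟨le_rfl, by omega⟩, ?_⟩
    have hT1 : T - 1 + 1 = T := by omega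
    have := (hΔ T hT).2
    simp only [windowDrift, Finset.Icc_self, Finset.sum_singleton, hT1]
    linarith [two_le_complexity hd δ 1]
  set M := s.max' ⟨1, h1⟩ with hMdef
  have hM : M ∈ s := s.max'_mem _
  rw [hs, Finset.mem_filter, Finset.mem_Icc] at hM
  obtain ⟨⟨hM1, hMT⟩, hMgood⟩ := hM
  have hM0 : (0 : ℝ) < M := by exact_mod_cast hM1
  have hC0 : ∀ m, 0 < complexity d δ m := fun m => by linarith [two_le_complexity hd δ m]
  refine ⟨M, hM1, hMT, fun m hm hmM => ?_, fun m hm hmT => ?_⟩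
  · have hm0 : (0 : ℝ) < m := by exact_mod_cast hm
    have := (hmono hm hmM hMT).trans
      ((div_le_div_of_nonneg_right hMgood hM0.le).trans (complexity_div_anti d δ hm hmM))
    exact (div_le_div_iff_of_pos_right hm0).1 this
  · have hm0 : (0 : ℝ) < m := by exact_mod_cast hm
    have hwb : windowBound d δ Δ T m = windowDrift Δ T m / m + complexity d δ m / m := by
      rw [windowBound, windowDrift]
      ring
    rw [hwb]
    rcases le_or_gt m M with hmM | hmM
    · have hnn : 0 ≤ windowDrift Δ T m := by
        refine Finset.sum_nonneg fun i hi => Finset.sum_nonneg fun j hj => (hΔ j ?_).1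
        rw [Finset.mem_Icc] at hi hj
        omega
      calc complexity d δ M / (2 * M) ≤ complexity d δ M / M := by
            have := (hC0 M).le
            gcongr
            linarith
        _ ≤ complexity d δ m / m := complexity_div_anti d δ hm hmM
        _ ≤ _ := le_add_of_nonneg_left (by positivity)
    · have hnot : M + 1 ∉ s := fun hmem => by
        have := s.le_max' _ hmem
        omega
      rw [hs, Finset.mem_filter, Finset.mem_Icc] at hnot
      have hlt : complexity d δ (M + 1) < windowDrift Δ T (M + 1) := by
        by_contra! hcon
        exact hnot ⟨⟨by omega, by omega⟩, hcon⟩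
      have h2 : (1 : ℝ) ≤ M := by exact_mod_cast hM1
      calc complexity d δ M / (2 * M) ≤ windowDrift Δ T (M + 1) / (2 * M) := by
            gcongr
            exact (complexity_mono d δ (Nat.le_succ M)).trans hlt.le
        _ ≤ windowDrift Δ T (M + 1) / (M + 1 : ℕ) := by
            have : 0 ≤ windowDrift Δ T (M + 1) := (hC0 _).le.trans hlt.le
            gcongr
            push_cast
            linarith
        _ ≤ windowDrift Δ T m / m := hmono (by omega) hmM hmT
        _ ≤ _ := le_add_of_nonneg_right (div_nonneg (hC0 m).le hm0.le)

/-! ### The algorithm -/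

lemma maxRatio_lt_iff {𝒳 : Type*} {d : ℕ} (hd : 1 ≤ d) (δ K : ℝ) {T : ℕ} (S : Sample 𝒳 T) {m : ℕ}
    (hm : 1 ≤ m) (h : 𝒳 → Bool) :
    maxRatio d δ S m h < K ↔
      ∀ m', 1 ≤ m' → m' ≤ m → (mistakes S m' h : ℝ) < K * complexity d δ m' := by
  have hC0 : ∀ m, 0 < complexity d δ m := fun m => by linarith [two_le_complexity hd δ m]
  constructor
  · intro hlt m' h1 h2
    rw [← div_lt_iff₀ (hC0 m')]
    exact (le_ciSup (f := fun m' : Finset.Icc 1 m => (mistakes S m' h : ℝ) / complexity d δ m')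
      (Set.finite_range _).bddAbove ⟨m', Finset.mem_Icc.2 ⟨h1, h2⟩⟩).trans_lt hlt
  · intro hall
    have : Nonempty (Finset.Icc 1 m) := ⟨⟨1, Finset.mem_Icc.2 ⟨le_rfl, hm⟩⟩⟩
    obtain ⟨⟨m', hm'⟩, heq⟩ := exists_eq_ciSup_of_finite
      (f := fun m' : Finset.Icc 1 m => (mistakes S m' h : ℝ) / complexity d δ m')
    rw [maxRatio, ← heq, div_lt_iff₀ (hC0 m')]
    exact hall m' (Finset.mem_Icc.1 hm').1 (Finset.mem_Icc.1 hm').2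

/-- The number of mistakes takes finitely many values, so that the `argmin` is attained. -/
lemma exists_isMinOn_maxRatio {𝒳 : Type*} {C : Set (𝒳 → Bool)} (hC : C.Nonempty) (d : ℕ) (δ : ℝ)
    {T : ℕ} (S : Sample 𝒳 T) (m : ℕ) : ∃ h ∈ C, IsMinOn (maxRatio d δ S m) C h := by
  have hfin : (maxRatio d δ S m '' C).Finite := by
    -- `maxRatio` depends on `h` only through the labels of `h` on the sample.
    let R : (Finset.Ico 1 T → Bool) → ℝ := fun y => ⨆ m' : Finset.Icc 1 m,
      (((Finset.univ.filter fun t : Finset.Ico 1 T =>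
        T - (m' : ℕ) ≤ (t : ℕ) ∧ y t ≠ (S t).2).card : ℕ) : ℝ) / complexity d δ m'
    refine (Set.finite_range R).subset ?_
    rintro _ ⟨h, -, rfl⟩
    exact ⟨fun t => h (S t).1, rfl⟩
  obtain ⟨_, ⟨h, hh, rfl⟩, hmin⟩ := hfin.exists_minimal (hC.image _)
  refine ⟨h, hh, fun h' hh' => ?_⟩
  by_contra hcon
  exact hcon (hmin ⟨h', hh', rfl⟩ (not_le.1 hcon).le)

lemma exists_isAdaptiveAlgorithm {𝒳 : Type*} {C : Set (𝒳 → Bool)} (hC : C.Nonempty) {d : ℕ}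
    (hd : 1 ≤ d) (δ : ℝ) {K : ℝ} (hK : 1 ≤ K) : ∃ A : Learner 𝒳, IsAdaptiveAlgorithm C d δ K A := by
  have key : ∀ T : ℕ, 2 ≤ T → ∀ S : Sample 𝒳 T, ∃ a : 𝒳 → Bool, ∃ mhat : ℕ,
      IsGreatest (admissibleWindows C d δ K S) mhat ∧ a ∈ C ∧
        IsMinOn (maxRatio d δ S mhat) C a := by
    intro T hT S
    obtain ⟨h, hh⟩ := hC
    have hfin : (admissibleWindows C d δ K S).Finite :=
      (Set.finite_Icc 1 (T - 1)).subset fun m hm => ⟨hm.1, hm.2.1⟩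
    -- The window of length `1` is admissible, since a single mistake is below the threshold.
    have hone : 1 ∈ admissibleWindows C d δ K S := by
      refine ⟨le_rfl, by omega, h, hh, (maxRatio_lt_iff hd δ K S le_rfl h).2 fun m' h1 h2 => ?_⟩
      obtain rfl : m' = 1 := by omega
      have hle : mistakes S 1 h ≤ 1 := by
        refine Finset.card_le_one.2 fun s hs t ht => ?_
        have hs' := (Finset.mem_filter.1 hs).2.1
        have ht' := (Finset.mem_filter.1 ht).2.1
        have hs2 := Finset.mem_Ico.1 s.2
        have ht2 := Finset.mem_Ico.1 t.2
        ext
        omega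
      have h2 : (mistakes S 1 h : ℝ) ≤ 1 := by exact_mod_cast hle
      nlinarith [two_le_complexity hd δ 1]
    obtain ⟨a, ha, hmin⟩ := exists_isMinOn_maxRatio ⟨h, hh⟩ d δ S
      (sSup (admissibleWindows C d δ K S))
    exact ⟨a, _, ⟨Nat.sSup_mem ⟨1, hone⟩ hfin.bddAbove, fun m hm => le_csSup hfin.bddAbove hm⟩,
      ha, hmin⟩
  choose A hA using key
  refine ⟨fun T S => if hT : 2 ≤ T then A T hT S else fun _ => true, fun T hT S => ?_⟩
  simpa [hT] using hA T hT S

lemma mistakes_observations {𝒳 Ω : Type*} (X : ℕ → Ω → 𝒳) (hstar : ℕ → 𝒳 → Bool) {T m : ℕ}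
    (hmT : m < T) (ω : Ω) (h : 𝒳 → Bool) :
    mistakes (observations X hstar T ω) m h =
      (Finset.univ.filter fun t : Finset.Ico (T - m) T =>
        (h (X t ω) ^^ hstar t (X t ω)) = true).card := by
  symm
  refine Finset.card_bij (fun t _ => ⟨t, ?_⟩) ?_ ?_ ?_
  · have := Finset.mem_Ico.1 t.2
    exact Finset.mem_Ico.2 ⟨by omega, this.2⟩
  · intro t ht
    rw [Finset.mem_filter] at ht ⊢
    exact ⟨Finset.mem_univ _, (Finset.mem_Ico.1 t.2).1, Bool.xor_iff_ne.1 ht.2⟩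
  · intro s _ t _ hst
    exact Subtype.ext (congrArg (fun u : Finset.Ico 1 T => (u : ℕ)) hst)
  · intro t ht
    rw [Finset.mem_filter] at ht
    exact ⟨⟨t, Finset.mem_Ico.2 ⟨ht.2.1, (Finset.mem_Ico.1 t.2).2⟩⟩,
      Finset.mem_filter.2 ⟨Finset.mem_univ _, Bool.xor_iff_ne.2 ht.2.2⟩, rfl⟩

/-! ### The event of high probability -/

/-- The observations in a window form an independent sample; an unlikely set of such samples is
avoided outside a measurable event which is just as unlikely. -/
lemma exists_measurableSet_avoid {𝒳 Ω : Type*} [MeasurableSpace 𝒳] [MeasurableSpace Ω]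
    {P : Measure 𝒳} [IsProbabilityMeasure P] {μ : Measure Ω} [IsProbabilityMeasure μ]
    {X : ℕ → Ω → 𝒳} (hX : ∀ t, 1 ≤ t → HasLaw (X t) P μ)
    (hind : iIndepFun (fun t => X (t + 1)) μ) {a T : ℕ} (ha : 1 ≤ a)
    (B : Set (Finset.Ico a T → 𝒳)) {b : ℝ}
    (hB : (Measure.pi fun _ : Finset.Ico a T => P).real B ≤ b) :
    ∃ N : Set Ω, MeasurableSet N ∧ μ.real N ≤ b ∧
      ∀ ω ∉ N, (fun t : Finset.Ico a T => X t ω) ∉ B := by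
  have hle : ∀ t : Finset.Ico a T, 1 ≤ (t : ℕ) := fun t => ha.trans (Finset.mem_Ico.1 t.2).1
  have hmeas : ∀ t : Finset.Ico a T, AEMeasurable (X t) μ := fun t => (hX t (hle t)).aemeasurable
  have hind' : iIndepFun (fun t : Finset.Ico a T => X t) μ := by
    have hinj : Function.Injective fun t : Finset.Ico a T => (t : ℕ) - 1 := by
      intro s t hst
      have h1 := hle s
      have h2 := hle t
      simp only at hst
      ext
      omega
    have h := hind.precomp hinj
    have heq : (fun t : Finset.Ico a T => X ((t : ℕ) - 1 + 1)) =
        fun t : Finset.Ico a T => X (t : ℕ) := by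
      ext t : 1
      rw [Nat.sub_add_cancel (hle t)]
    rwa [heq] at h
  have hlaw : μ.map (fun ω (t : Finset.Ico a T) => X t ω) =
      Measure.pi fun _ : Finset.Ico a T => P := by
    rw [(iIndepFun_iff_map_fun_eq_pi_map hmeas).1 hind']
    congr 1
    ext1 t
    exact (hX t (hle t)).map_eq
  set Z : Ω → Finset.Ico a T → 𝒳 := fun ω t => X t ω with hZ
  have hZm : AEMeasurable Z μ := aemeasurable_pi_lambda _ hmeas
  set V := toMeasurable (Measure.pi fun _ : Finset.Ico a T => P) B with hV
  refine ⟨toMeasurable μ (Z ⁻¹' V), measurableSet_toMeasurable _ _, ?_, fun ω hω hmem => ?_⟩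
  · rw [measureReal_def, measure_toMeasurable,
      ← Measure.map_apply_of_aemeasurable hZm (measurableSet_toMeasurable _ _), hlaw,
      measure_toMeasurable]
    exact hB
  · exact hω (subset_toMeasurable _ _ (subset_toMeasurable _ _ hmem))

lemma exp_neg_two_le : Real.exp (-2) ≤ 1 / 4 := by
  have h : Real.exp (-1) ≤ 1 / 2 := (exp_neg_le (by norm_num)).trans_eq (by norm_num)
  calc Real.exp (-2) = Real.exp (-1) * Real.exp (-1) := by rw [← Real.exp_add]; norm_num
    _ ≤ 1 / 2 * (1 / 2) := by gcongr
    _ = 1 / 4 := by norm_num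

/-- The failure probability of a window, summable over the window lengths. -/
lemma exp_neg_complexity_le_inv_sq {d : ℕ} (hd : 1 ≤ d) {δ : ℝ} (hδ : 0 < δ) (hδ1 : δ < 1) {m : ℕ}
    (hm : 1 ≤ m) : Real.exp (-(3 * complexity d δ m)) ≤ δ / 4 * ((m : ℝ) ^ 2)⁻¹ := by
  have hm0 : (0 : ℝ) < m := by exact_mod_cast hm
  have h1 := log_add_log_le_complexity hd hδ hm
  have h2 := two_le_complexity hd δ m
  have h3 : Real.log (1 / δ) = -Real.log δ := by rw [one_div, Real.log_inv]
  have h4 : Real.log δ ≤ 0 := Real.log_nonpos hδ.le hδ1.le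
  calc Real.exp (-(3 * complexity d δ m))
      ≤ Real.exp (-2 + (Real.log δ + (-Real.log m + -Real.log m))) :=
        Real.exp_le_exp.2 (by linarith)
    _ = Real.exp (-2) * (δ * ((m : ℝ) ^ 2)⁻¹) := by
        rw [Real.exp_add, Real.exp_add, Real.exp_add, Real.exp_neg (Real.log m), Real.exp_log hδ,
          Real.exp_log hm0, ← mul_inv, sq]
    _ ≤ 1 / 4 * (δ * ((m : ℝ) ^ 2)⁻¹) := by
        gcongr
        exact exp_neg_two_le
    _ = _ := by ring

lemma exp_neg_complexity_le {d : ℕ} (hd : 1 ≤ d) {δ : ℝ} (hδ : 0 < δ) {m : ℕ}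
    (hm : 1 ≤ m) : Real.exp (-(2 * complexity d δ m)) ≤ δ / 4 := by
  have h1 := log_add_log_le_complexity hd hδ hm
  have h2 := two_le_complexity hd δ m
  have h3 : Real.log (1 / δ) = -Real.log δ := by rw [one_div, Real.log_inv]
  have h4 : 0 ≤ Real.log m := Real.log_natCast_nonneg m
  calc Real.exp (-(2 * complexity d δ m)) ≤ Real.exp (-2 + Real.log δ) :=
        Real.exp_le_exp.2 (by linarith)
    _ = Real.exp (-2) * δ := by rw [Real.exp_add, Real.exp_log hδ]
    _ ≤ 1 / 4 * δ := by
        gcongr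
        exact exp_neg_two_le
    _ = _ := by ring

lemma sum_inv_sq_le (M : ℕ) : ∑ m ∈ Finset.Icc 1 M, ((m : ℝ) ^ 2)⁻¹ ≤ 2 := by
  rcases Nat.eq_zero_or_pos M with rfl | hM
  · simp
  have key : ∑ m ∈ Finset.Icc 1 M, ((m : ℝ) ^ 2)⁻¹ ≤ 2 - (M : ℝ)⁻¹ := by
    induction M, hM using Nat.le_induction with
    | base => norm_num
    | succ M hM ih =>
      have hM0 : (0 : ℝ) < M := by exact_mod_cast hM
      rw [Finset.sum_Icc_succ_top (by omega)]
      have hstep : (((M + 1 : ℕ) : ℝ) ^ 2)⁻¹ ≤ (M : ℝ)⁻¹ - ((M + 1 : ℕ) : ℝ)⁻¹ := by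
        push_cast
        rw [inv_sub_inv hM0.ne' (by positivity), inv_eq_one_div,
          div_le_div_iff₀ (by positivity) (by positivity)]
        nlinarith
      linarith
  have : (0 : ℝ) ≤ (M : ℝ)⁻¹ := by positivity
  linarith

/-- On a window whose accumulated drift is at most its complexity, the current target is unlikely
to reach the threshold of the algorithm. -/
lemma measureReal_threshold_le {𝒳 : Type*} [MeasurableSpace 𝒳] {C : Set (𝒳 → Bool)}
    (hmeas : ∀ h ∈ C, Measurable h) {P : Measure 𝒳} [IsProbabilityMeasure P] {d : ℕ} (hd : 1 ≤ d)
    {δ : ℝ} (hδ : 0 < δ) (hδ1 : δ < 1) {Δ : ℕ → ℝ} {hstar : ℕ → 𝒳 → Bool}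
    (hS : hstar ∈ driftSet C P Δ) {T m : ℕ} (hm : 1 ≤ m) (hmT : m < T)
    (hdrift : windowDrift Δ T m ≤ complexity d δ m) :
    (Measure.pi fun _ : Finset.Ico (T - m) T => P).real
        {x | 5 * complexity d δ m ≤ 1 * ((Finset.univ.filter fun t : Finset.Ico (T - m) T =>
          (hstar T (x t) ^^ hstar t (x t)) = true).card : ℝ)} ≤ δ / 4 * ((m : ℝ) ^ 2)⁻¹ := by
  have hmem : ∀ t, 1 ≤ t → Measurable (hstar t) := fun t ht => hmeas _ (hS t ht).1
  have hle : ∀ t : Finset.Ico (T - m) T, 1 ≤ (t : ℕ) ∧ (t : ℕ) ≤ T := fun t => by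
    have := Finset.mem_Ico.1 t.2
    omega
  have hxor : Measurable fun p : Bool × Bool => (p.1 ^^ p.2) := measurable_of_finite _
  have hc := chernoff_count P (fun (t : Finset.Ico (T - m) T) x => hstar T x ^^ hstar t x)
    (fun t => hxor.comp ((hmem T (by omega)).prodMk (hmem t (hle t).1))) 1 (5 * complexity d δ m)
  refine hc.trans (le_trans ?_ (exp_neg_complexity_le_inv_sq hd hδ hδ1 hm))
  have hsum : ∑ t : Finset.Ico (T - m) T, P.real {y | (hstar T y ^^ hstar t y) = true} ≤
      complexity d δ m := by
    refine le_trans ?_ hdrift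
    have hIcc : Finset.Icc (T - m) (T - 1) = Finset.Ico (T - m) T := by
      ext i
      simp only [Finset.mem_Icc, Finset.mem_Ico]
      omega
    rw [windowDrift, hIcc, ← Finset.sum_coe_sort (Finset.Ico (T - m) T)]
    refine Finset.sum_le_sum fun t _ => ?_
    rw [← disagreement_eq]
    exact disagreement_le_sum_drift hS (hle t).1 (hle t).2
  have he : Real.exp 1 - 1 ≤ 2 := by linarith [Real.exp_one_lt_d9]
  have h0 : 0 ≤ ∑ t : Finset.Ico (T - m) T, P.real {y | (hstar T y ^^ hstar t y) = true} :=
    Finset.sum_nonneg fun _ _ => measureReal_nonneg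
  refine Real.exp_le_exp.2 ?_
  nlinarith

/-- On a window of length `m`, it is unlikely that some classifier differs rarely from the target
`g` on the sample but has large error. -/
lemma measureReal_exists_large_error_le {𝒳 : Type*} [MeasurableSpace 𝒳] {C : Set (𝒳 → Bool)}
    (hmeas : ∀ h ∈ C, Measurable h) {P : Measure 𝒳} [IsProbabilityMeasure P]
    (hC : MeasurableRealization C P) {d : ℕ} (hd : 1 ≤ d) (hvc : HasVCDim C d) {δ : ℝ}
    (hδ : 0 < δ) {g : 𝒳 → Bool} (hg : Measurable g) {ι : Type*} [Fintype ι] [DecidableEq ι] {m : ℕ}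
    (hm : 1 ≤ m) (hι : Fintype.card ι = m) :
    (Measure.pi fun _ : ι => P).real
        {x | ∃ h ∈ errorClass C g,
          ((Finset.univ.filter fun i => h (x i) = true).card : ℝ) ≤ 10 * complexity d δ m ∧
          80 * complexity d δ m / m ≤ P.real {x | h x = true}} ≤ δ / 2 := by
  have hm0 : (0 : ℝ) < m := by exact_mod_cast hm
  have h2 := two_le_complexity hd δ m
  have hxor : Measurable fun p : Bool × Bool => (p.1 ^^ p.2) := measurable_of_finite _
  have hvc' : ∀ s, Shatters (errorClass C g) s → s.card ≤ d := fun s hs =>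
    hvc.2 ⟨s, rfl, shatters_of_shatters_errorClass hs⟩
  have hmeas' : ∀ h ∈ errorClass C g, Measurable h := by
    rintro _ ⟨h, hh, rfl⟩
    exact hxor.comp ((hmeas h hh).prodMk hg)
  have hcancel : (Fintype.card ι : ℝ) * (80 * complexity d δ m / m) = 80 * complexity d δ m := by
    rw [hι]
    field_simp
  have h := measureReal_exists_deviation_le hmeas' (hC.errorClass hg) hvc' ι
    (ε := 80 * complexity d δ m / m) (10 * complexity d δ m) (by rw [hcancel]; linarith)
  rw [hcancel, hι] at h
  refine h.trans ?_
  have hgrowth : (∑ j ∈ Finset.Iic d, ((m + m).choose j : ℝ)) ≤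
      Real.exp (3 * complexity d δ m) := by
    refine (sum_choose_le_exp hd m).trans (Real.exp_le_exp.2 ?_)
    have := one_le_Log (1 / δ)
    unfold complexity
    linarith
  calc 2 * (Real.exp (10 * complexity d δ m / 2 - 80 * complexity d δ m / 8) *
        ∑ j ∈ Finset.Iic d, ((m + m).choose j : ℝ))
      ≤ 2 * (Real.exp (10 * complexity d δ m / 2 - 80 * complexity d δ m / 8) *
        Real.exp (3 * complexity d δ m)) := by gcongr
    _ = 2 * Real.exp (-(2 * complexity d δ m)) := by
        rw [← Real.exp_add]
        ring_nf
    _ ≤ 2 * (δ / 4) := by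
        gcongr
        exact exp_neg_complexity_le hd hδ hm
    _ = δ / 2 := by ring

/-- The pointwise part of the argument: if the current target stays below the threshold on all
windows up to length `M`, the algorithm uses a window of length at least `M`, and its output
differs rarely from the current target on the last `M` observations. -/
lemma card_disagree_le {𝒳 Ω : Type*} {C : Set (𝒳 → Bool)} {d : ℕ} (hd : 1 ≤ d) {δ : ℝ}
    {A : Learner 𝒳} (hA : IsAdaptiveAlgorithm C d δ 5 A) {X : ℕ → Ω → 𝒳} {hstar : ℕ → 𝒳 → Bool}
    {T M : ℕ} (hT : 2 ≤ T) (hM : 1 ≤ M) (hMT : M ≤ T - 1) (htar : hstar T ∈ C) {ω : Ω}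
    (hω : ∀ m, 1 ≤ m → m ≤ M →
      (mistakes (observations X hstar T ω) m (hstar T) : ℝ) < 5 * complexity d δ m) :
    A T (observations X hstar T ω) ∈ C ∧
      ((Finset.univ.filter fun t : Finset.Ico (T - M) T =>
        (A T (observations X hstar T ω) (X t ω) ^^ hstar T (X t ω)) = true).card : ℝ) ≤
        10 * complexity d δ M := by
  set S := observations X hstar T ω with hS
  obtain ⟨mhat, hmhat, hAC, hmin⟩ := hA T hT S
  have hMm : M ≤ mhat :=
    hmhat.2 ⟨hM, hMT, hstar T, htar, (maxRatio_lt_iff hd δ 5 S hM _).2 hω⟩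
  obtain ⟨hm1, -, h0, h0C, h0lt⟩ := hmhat.1
  have hAlt := (maxRatio_lt_iff hd δ 5 S hm1 _).1 ((hmin h0C).trans_lt h0lt) M hM hMm
  refine ⟨hAC, ?_⟩
  have htlt := hω M hM le_rfl
  rw [hS, mistakes_observations X hstar (by omega)] at hAlt htlt
  rw [← hS] at hAlt
  have hunion : (Finset.univ.filter fun t : Finset.Ico (T - M) T =>
      (A T S (X t ω) ^^ hstar T (X t ω)) = true).card ≤
      (Finset.univ.filter fun t : Finset.Ico (T - M) T =>
        (A T S (X t ω) ^^ hstar t (X t ω)) = true).card +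
      (Finset.univ.filter fun t : Finset.Ico (T - M) T =>
        (hstar T (X t ω) ^^ hstar t (X t ω)) = true).card := by
    classical
    refine (Finset.card_le_card fun t ht => ?_).trans (Finset.card_union_le _ _)
    simp only [Finset.mem_union, Finset.mem_filter, Finset.mem_univ, true_and] at ht ⊢
    revert ht
    cases A T S (X t ω) <;> cases hstar T (X t ω) <;> cases hstar t (X t ω) <;> simp
  have : ((Finset.univ.filter fun t : Finset.Ico (T - M) T =>
      (A T S (X t ω) ^^ hstar T (X t ω)) = true).card : ℝ) ≤ _ := Nat.cast_le.2 hunion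
  push_cast at this
  linarith

end DriftLearning

theorem theorem1 :
    ∃ K : ℝ, 1 ≤ K ∧ ∃ c : ℝ, 0 < c ∧
      ∀ (𝒳 : Type*) [MeasurableSpace 𝒳] (C : Set (𝒳 → Bool)) (d : ℕ) (δ : ℝ),
        (∀ h ∈ C, Measurable h) → 1 ≤ d → DriftLearning.HasVCDim C d → 0 < δ → δ < 1 →
        (∃ A : DriftLearning.Learner 𝒳, DriftLearning.IsAdaptiveAlgorithm C d δ K A) ∧
        ∀ A : DriftLearning.Learner 𝒳, DriftLearning.IsAdaptiveAlgorithm C d δ K A →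
          ∀ (P : Measure 𝒳) [IsProbabilityMeasure P],
            DriftLearning.MeasurableRealization C P →
            ∀ Δ : ℕ → ℝ, (∀ t, 2 ≤ t → Δ t ∈ Set.Icc (0 : ℝ) 1) →
            ∀ hstar ∈ DriftLearning.driftSet C P Δ,
            ∀ (Ω : Type*) [MeasurableSpace Ω] (μ : Measure Ω) [IsProbabilityMeasure μ]
              (X : ℕ → Ω → 𝒳),
              (∀ t, 1 ≤ t → HasLaw (X t) P μ) → iIndepFun (fun t => X (t + 1)) μ →
              ∀ (T : ℕ) (hT : 2 ≤ T),
                ∃ E : Set Ω, MeasurableSet E ∧ 1 - δ ≤ μ.real E ∧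
                  ∀ ω ∈ E,
                    DriftLearning.disagreement P
                        (A T (DriftLearning.observations X hstar T ω)) (hstar T) ≤
                      c * (Finset.Icc 1 (T - 1)).inf' (Finset.nonempty_Icc.2 (by omega))
                        (fun m => DriftLearning.windowBound d δ Δ T m) := by
  refine ⟨5, by norm_num, 160, by norm_num, fun 𝒳 _ C d δ hmeas hd hvc hδ hδ1 => ⟨?_, ?_⟩⟩
  · obtain ⟨s, -, hs⟩ := hvc.1
    obtain ⟨h, hh, -⟩ := hs fun _ => true
    exact DriftLearning.exists_isAdaptiveAlgorithm ⟨h, hh⟩ hd δ (by norm_num)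
  intro A hA P _ hC Δ hΔ hstar hS Ω _ μ _ X hX hind T hT
  obtain ⟨M, hM1, hMT, hdrift, hbound⟩ := DriftLearning.exists_balanced_window hd δ hΔ hT
  have htar : hstar T ∈ C := (hS T (by omega)).1
  have hthr : ∀ m : ℕ, ∃ N : Set Ω, 1 ≤ m → m ≤ M → MeasurableSet N ∧
      μ.real N ≤ δ / 4 * ((m : ℝ) ^ 2)⁻¹ ∧ ∀ ω ∉ N,
        (DriftLearning.mistakes (DriftLearning.observations X hstar T ω) m (hstar T) : ℝ) <
          5 * DriftLearning.complexity d δ m := by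
    intro m
    by_cases hm : 1 ≤ m ∧ m ≤ M
    · obtain ⟨N, hN, hNμ, hNω⟩ := DriftLearning.exists_measurableSet_avoid hX hind
        (show 1 ≤ T - m by omega) _ (DriftLearning.measureReal_threshold_le hmeas hd hδ hδ1 hS hm.1
          (by omega) (hdrift m hm.1 hm.2))
      refine ⟨N, fun _ _ => ⟨hN, hNμ, fun ω hω => ?_⟩⟩
      rw [DriftLearning.mistakes_observations X hstar (by omega)]
      simpa using hNω ω hω
    · exact ⟨∅, fun h1 h2 => absurd ⟨h1, h2⟩ hm⟩
  choose N hN using hthr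
  obtain ⟨N', hN', hN'μ, hN'ω⟩ := DriftLearning.exists_measurableSet_avoid hX hind
    (show 1 ≤ T - M by omega) _ (DriftLearning.measureReal_exists_large_error_le hmeas hC hd hvc hδ
      (hmeas _ htar) (ι := Finset.Ico (T - M) T) hM1 (by simp; omega))
  have hNm : MeasurableSet ((⋃ m ∈ Finset.Icc 1 M, N m) ∪ N') :=
    (Finset.measurableSet_biUnion _ fun m hm =>
      (hN m (Finset.mem_Icc.1 hm).1 (Finset.mem_Icc.1 hm).2).1).union hN'
  refine ⟨((⋃ m ∈ Finset.Icc 1 M, N m) ∪ N')ᶜ, hNm.compl, ?_, fun ω hω => ?_⟩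
  · have h1 : μ.real (⋃ m ∈ Finset.Icc 1 M, N m) ≤ δ / 2 := by
      calc μ.real (⋃ m ∈ Finset.Icc 1 M, N m) ≤ ∑ m ∈ Finset.Icc 1 M, μ.real (N m) :=
            measureReal_biUnion_finset_le _ _
        _ ≤ ∑ m ∈ Finset.Icc 1 M, δ / 4 * ((m : ℝ) ^ 2)⁻¹ := Finset.sum_le_sum fun m hm =>
            (hN m (Finset.mem_Icc.1 hm).1 (Finset.mem_Icc.1 hm).2).2.1
        _ ≤ δ / 4 * 2 := by
            rw [← Finset.mul_sum]
            gcongr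
            exact DriftLearning.sum_inv_sq_le M
        _ = δ / 2 := by ring
    have h2 := measureReal_union_le (μ := μ) (⋃ m ∈ Finset.Icc 1 M, N m) N'
    rw [probReal_compl_eq_one_sub hNm]
    linarith
  · simp only [Set.mem_compl_iff, Set.mem_union, Set.mem_iUnion, not_or, not_exists] at hω
    obtain ⟨hAC, hcard⟩ := DriftLearning.card_disagree_le hd hA hT hM1 hMT htar
      fun m h1 h2 => (hN m h1 h2).2.2 ω (hω.1 m (Finset.mem_Icc.2 ⟨h1, h2⟩))
    have herr : DriftLearning.disagreement P
        (A T (DriftLearning.observations X hstar T ω)) (hstar T) <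
        80 * DriftLearning.complexity d δ M / M := by
      by_contra! hcon
      rw [DriftLearning.disagreement_eq] at hcon
      exact hN'ω ω hω.2 ⟨_, ⟨_, hAC, rfl⟩, hcard, hcon⟩
    obtain ⟨m, hm, heq⟩ := Finset.exists_mem_eq_inf' (Finset.nonempty_Icc.2 (by omega))
      (fun m => DriftLearning.windowBound d δ Δ T m) (s := Finset.Icc 1 (T - 1))
    rw [heq]
    calc _ ≤ 80 * DriftLearning.complexity d δ M / M := herr.le
      _ = 160 * (DriftLearning.complexity d δ M / (2 * M)) := by ring
      _ ≤ _ := by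
        gcongr
        exact hbound m (Finset.mem_Icc.1 hm).1 (Finset.mem_Icc.1 hm).2
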